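/- Let $G$ be a nonempty finite simple graph (connected or not) embedded in the torus; the embedding need not be cellular. A $k$-vertex ($k^-$-vertex) is a vertex of degree $k$ (at most $k$); a $k$-neighbour of $v$ is a neighbour of $v$ of degree $k$. The length $\ell(f)$ of a face $f$ is the total length of the walks that bound it, and a $k$-face is a face of length $k$. A face is \emph{expensive} if it is a 3-face with a 3-vertex or a 4-face with two 3-vertices; a 3-face is \emph{costly} if it contains a 4-vertex. Then the embedded graph contains at least one of the following (reducible) configurations: 1. a $2^-$-vertex; 2. a 3-vertex adjacent to a 4-vertex; 3. two adjacent 3-vertices; 4. a 3-face with two 4-vertices; 5. two 3-faces sharing an edge that has a $4^-$-vertex as an end, or a 5-vertex on at least three 3-faces; 6. a 6-vertex on at least five 3-faces; 7. a 5- or 6-vertex that is on at least two 3-faces and has a 3-neighbour, or that is on a costly 3-face and on at least one other 3-face; 8. a vertex $v$ of degree $d$ with exactly $k$ 3-neighbours and lying on exactly $m$ expensive faces, where $d=5$ and ($k\in\{2,3,4\}$, or $k=5$ and $m\ge 1$); or $d=6$ and ($k\in\{2,3\}$, or $k=4$ and $m\ge1$, or $k=5$ and $m\ge2$, or $k=6$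 and $m\ge3$); or $d=7$ and ($k=2$, or $k=3$ and $m\ge1$, or $k=4$ and $m\ge2$, or $k=5$ and $m\ge3$, or $k=6$ and $m\ge4$); 9. an expensive 4-face sharing an edge with a 3-face; 10. a 4-face all of whose vertices are 4-vertices. -/

import Mathlib

/-- A rotation system of a graph: at each vertex, a cyclic order of the darts (oriented edges)
leaving it.  `rot d` is the dart that follows `d` around its tail. -/
structure RotationSystem {V : Type*} (G : SimpleGraph V) where
  rot : Equiv.Perm G.Dart
  fst_rot : ∀ d, (rot d).fst = d.fst
  cyclic : ∀ d e : G.Dart, d.fst = e.fst → rot.SameCycle d e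

namespace RotationSystem

/-- The facial permutation: after traversing the dart `u → v`, continue with the dart that follows
`v → u` around `v`.  Its cycles are the facial walks. -/
def next {V : Type*} {G : SimpleGraph V} (R : RotationSystem G) : Equiv.Perm G.Dart :=
  (SimpleGraph.Dart.symm_involutive (G := G)).toPerm.trans R.rot

/-- The facial walks: the cycles of the facial permutation and, for every isolated vertex, the walk
of length zero at that vertex. -/
abbrev FacialWalk {V : Type*} {G : SimpleGraph V} (R : RotationSystem G) : Type _ :=
  Quotient (Equiv.Perm.SameCycle.setoid R.next) ⊕ {v : V // ∀ w, ¬ G.Adj v w}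

/-- The facial walk that contains a given dart. -/
def walkOf {V : Type*} {G : SimpleGraph V} (R : RotationSystem G) (d : G.Dart) : R.FacialWalk :=
  Sum.inl (Quotient.mk (Equiv.Perm.SameCycle.setoid R.next) d)

/-- The vertex `v` occurs on the facial walk `c`. -/
def OnWalk {V : Type*} {G : SimpleGraph V} (R : RotationSystem G) (v : V) (c : R.FacialWalk) :
    Prop :=
  (∃ d : G.Dart, d.fst = v ∧ R.walkOf d = c) ∨
    ∃ h : ∀ w, ¬ G.Adj v w, c = Sum.inr ⟨v, h⟩

end RotationSystem

/-- An embedding, up to homeomorphism, of a graph (not necessarily connected) in a closed connected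
oriented surface, the embedding not necessarily being cellular.  It is given by the rotations at the
vertices and by the faces: a face is the interior of a compact connected oriented surface whose
boundary components are glued along facial walks.  Thus each facial walk belongs to one face, a face
has at least one facial walk on its boundary, and it has a genus (an open disc is a face of genus
`0` with one facial walk).  The last field says that the surface is connected. -/
structure SurfaceEmbedding {V : Type*} (G : SimpleGraph V) extends RotationSystem G where
  Face : Type
  fintypeFace : Fintype Face
  faceOfWalk : toRotationSystem.FacialWalk → Face
  faceOfWalk_surjective : Function.Surjective faceOfWalk
  genus : Face → ℕ
  connected : ∀ u v : V, Relation.ReflTransGen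
    (fun x y => ∃ c c', toRotationSystem.OnWalk x c ∧ toRotationSystem.OnWalk y c' ∧
      faceOfWalk c = faceOfWalk c') u v

attribute [instance] SurfaceEmbedding.fintypeFace

namespace SurfaceEmbedding

/-- The Euler characteristic of the surface: `|V| - |E|` plus the sum of the Euler characteristics
`2 - 2g - b` of the faces, `g` being the genus and `b` the number of boundary walks of the face. -/
noncomputable def eulerChar {V : Type*} {G : SimpleGraph V} (M : SurfaceEmbedding G) : ℤ :=
  (Nat.card V : ℤ) - Nat.card G.edgeSet +
    ∑ f : M.Face, (2 - 2 * (M.genus f : ℤ) - Nat.card {c // M.faceOfWalk c = f})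

/-- The surface is the torus (the closed connected orientable surface of Euler characteristic
zero). -/
def IsToroidal {V : Type*} {G : SimpleGraph V} (M : SurfaceEmbedding G) : Prop :=
  M.eulerChar = 0

/-- The face on the side of a dart. -/
def face {V : Type*} {G : SimpleGraph V} (M : SurfaceEmbedding G) (d : G.Dart) : M.Face :=
  M.faceOfWalk (M.walkOf d)

/-- The length `ℓ(f)`: the total length of the boundary walks of `f`. -/
noncomputable def len {V : Type*} {G : SimpleGraph V} (M : SurfaceEmbedding G) (f : M.Face) : ℕ :=
  Nat.card {d : G.Dart // M.face d = f}

/-- The vertex `v` is on the boundary of the face `f`. -/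
def On {V : Type*} {G : SimpleGraph V} (M : SurfaceEmbedding G) (v : V) (f : M.Face) : Prop :=
  ∃ c, M.OnWalk v c ∧ M.faceOfWalk c = f

section

variable {V : Type*} [Fintype V] {G : SimpleGraph V} [DecidableRel G.Adj] (M : SurfaceEmbedding G)

/-- A face is expensive if it is a 3-face with a 3-vertex or a 4-face with two 3-vertices. -/
def Expensive (f : M.Face) : Prop :=
  (M.len f = 3 ∧ ∃ v, M.On v f ∧ G.degree v = 3) ∨
    (M.len f = 4 ∧ ∃ u v, u ≠ v ∧ M.On u f ∧ M.On v f ∧ G.degree u = 3 ∧ G.degree v = 3)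

/-- A 3-face is costly if it contains a 4-vertex. -/
def Costly (f : M.Face) : Prop :=
  M.len f = 3 ∧ ∃ v, M.On v f ∧ G.degree v = 4

/-- The number of 3-faces that `v` is on. -/
noncomputable def threeFaces (v : V) : ℕ :=
  Nat.card {f : M.Face // M.On v f ∧ M.len f = 3}

/-- The number of expensive faces that `v` is on. -/
noncomputable def expensiveFaces (v : V) : ℕ :=
  Nat.card {f : M.Face // M.On v f ∧ M.Expensive f}

end

end SurfaceEmbedding

/-- The number of 3-neighbours (neighbours of degree 3) of `v`. -/
noncomputable def threeNeighbors {V : Type*} [Fintype V] (G : SimpleGraph V) [DecidableRel G.Adj]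
    (v : V) : ℕ :=
  Nat.card {u : V // G.Adj v u ∧ G.degree u = 3}

/-- The excluded triples: degree `d`, number `k` of 3-neighbours, number `m` of expensive faces. -/
def ExcludedTriple (d k m : ℕ) : Prop :=
  (d = 5 ∧ (k = 2 ∨ k = 3 ∨ k = 4)) ∨
  (d = 5 ∧ k = 5 ∧ 1 ≤ m) ∨
  (d = 6 ∧ (k = 2 ∨ k = 3)) ∨
  (d = 6 ∧ k = 4 ∧ 1 ≤ m) ∨
  (d = 6 ∧ k = 5 ∧ 2 ≤ m) ∨
  (d = 6 ∧ k = 6 ∧ 3 ≤ m) ∨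
  (d = 7 ∧ k = 2) ∨
  (d = 7 ∧ k = 3 ∧ 1 ≤ m) ∨
  (d = 7 ∧ k = 4 ∧ 2 ≤ m) ∨
  (d = 7 ∧ k = 5 ∧ 3 ≤ m) ∨
  (d = 7 ∧ k = 6 ∧ 4 ≤ m)

/-- The embedded graph has one of the reducible configurations. -/
inductive SurfaceEmbedding.HasReducibleConfiguration {V : Type*} [Fintype V] {G : SimpleGraph V}
    [DecidableRel G.Adj] (M : SurfaceEmbedding G) : Prop
  /-- a vertex of degree at most 2 -/
  | twoMinusVertex (v : V) (h : G.degree v ≤ 2)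
  /-- adjacent 3- and 4-vertices -/
  | adjacentThreeFour (u v : V) (h : G.Adj u v) (hu : G.degree u = 3) (hv : G.degree v = 4)
  /-- adjacent 3-vertices -/
  | adjacentThreeThree (u v : V) (h : G.Adj u v) (hu : G.degree u = 3) (hv : G.degree v = 3)
  /-- a 3-face with two 4-vertices -/
  | fourVerticesOnThreeFace (f : M.Face) (u v : V) (hf : M.len f = 3) (hne : u ≠ v)
      (hu : M.On u f) (hv : M.On v f) (du : G.degree u = 4) (dv : G.degree v = 4)
  /-- two 3-faces that share an edge with an end of degree at most 4 -/
  | adjacentThreeFaces (d : G.Dart) (h : M.face d ≠ M.face d.symm) (h₁ : M.len (M.face d) = 3)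
      (h₂ : M.len (M.face d.symm) = 3) (hd : G.degree d.fst ≤ 4)
  /-- a 5-vertex on three 3-faces -/
  | fiveVertex (v : V) (hv : G.degree v = 5) (h : 3 ≤ M.threeFaces v)
  /-- a 6-vertex on five 3-faces -/
  | sixVertex (v : V) (hv : G.degree v = 6) (h : 5 ≤ M.threeFaces v)
  /-- a 5- or 6-vertex that has a 3-neighbour and is on two 3-faces -/
  | threeFacesAndThreeNeighbor (u v : V) (hv : G.degree v = 5 ∨ G.degree v = 6)
      (h : 2 ≤ M.threeFaces v) (huv : G.Adj v u) (hu : G.degree u = 3)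
  /-- a 5- or 6-vertex on a costly 3-face and on another 3-face -/
  | threeFacesAndCostly (v : V) (f : M.Face) (hv : G.degree v = 5 ∨ G.degree v = 6)
      (h : 2 ≤ M.threeFaces v) (hvf : M.On v f) (hf : M.Costly f)
  /-- a 5-, 6- or 7-vertex with an excluded number of 3-neighbours and expensive faces -/
  | threeNeighborsAndExpensiveFaces (v : V)
      (h : ExcludedTriple (G.degree v) (threeNeighbors G v) (M.expensiveFaces v))
  /-- an expensive 4-face that shares an edge with a 3-face -/
  | threeAndFourFaces (d : G.Dart) (h₁ : M.len (M.face d) = 3)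
      (h₂ : M.len (M.face d.symm) = 4) (h : M.Expensive (M.face d.symm))
  /-- a 4-face all of whose vertices have degree 4 -/
  | fourFaceOfFourVertices (f : M.Face) (hf : M.len f = 4) (h : ∀ v, M.On v f → G.degree v = 4)

/-! The proof is by discharging, with all charges scaled by six. A vertex starts with 6(deg − 4) and
a face with 6(ℓ − 4). Every face has Euler characteristic at most 1, so on the torus |E| ≤ |V| +
|F|, cellular or not, and the total 24(|E| − |V| − |F|) is at most 0.

Suppose that no configuration occurs. A vertex of degree at least 5 gives each of its triangles 3 if
the triangle has a vertex of degree at most 4, and 2 otherwise. A face of length at least 5 gives 3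
to each corner at a 3-vertex. A 3-vertex with L corners on such long faces takes max(0, 2 − L) from
each neighbour. Faces and vertices of degree 3 or 4 end nonnegative.

The crux is `sent_lt`: a vertex of degree at least 5 ends positive. Its gifts to neighbours are
bounded by two per 3-neighbour, by the savings at long corners between consecutive 3-neighbours
(`sentToVertices_le_of_expensiveFaces`), and by two per corner outside triangles
(`sentToVertices_le_of_triangleCorners`).

As the total is at most 0, no vertex has degree 5 or more. All neighbours of a 3-vertex would have
such a degree, so every vertex is a 4-vertex, and then no length is possible for a face. -/

open Finset

/-! ### Darts and rotations -/

namespace RotationSystem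

section

variable {V : Type*} {G : SimpleGraph V} (R : RotationSystem G)

theorem fst_next (d : G.Dart) : (R.next d).fst = d.snd := R.fst_rot d.symm

theorem next_eq (d : G.Dart) : R.next d = R.rot d.symm := rfl

theorem fst_rot_symm (d : G.Dart) : (R.rot.symm d).fst = d.fst := by
  conv_rhs => rw [← R.rot.apply_symm_apply d, R.fst_rot]

theorem next_symm_rot_symm (d : G.Dart) : R.next (R.rot.symm d).symm = d := by
  rw [next_eq, SimpleGraph.Dart.symm_symm, Equiv.apply_symm_apply]

theorem walkOf_next (d : G.Dart) : R.walkOf (R.next d) = R.walkOf d := by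
  unfold walkOf
  congr 1
  exact Quotient.sound (Equiv.Perm.sameCycle_apply_left.2 (Equiv.Perm.SameCycle.refl _ _))

theorem next_ne_self (d : G.Dart) : R.next d ≠ d := fun h => by
  have h' := R.fst_next d
  rw [h] at h'
  exact d.adj.ne h'

variable [Fintype V] [DecidableRel G.Adj]

theorem rot_ne_self (d : G.Dart) (h : 2 ≤ G.degree d.fst) : R.rot d ≠ d := by
  intro hd
  obtain ⟨w, hw, hne⟩ := Finset.exists_mem_ne (s := G.neighborFinset d.fst)
    (by rw [SimpleGraph.card_neighborFinset_eq_degree]; omega) d.snd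
  rw [SimpleGraph.mem_neighborFinset] at hw
  have h1 := R.cyclic d ⟨(d.fst, w), hw⟩ rfl
  have h2 := h1.eq_of_left hd
  apply hne
  rw [h2]

/-- A facial walk turns straight back only where the rotation fixes a dart, that is, at a vertex of
degree one. -/
theorem fst_next_next_ne (d : G.Dart) (h : 2 ≤ G.degree d.snd) :
    (R.next (R.next d)).fst ≠ d.fst := by
  intro hd
  rw [fst_next] at hd
  have h1 : R.next d = d.symm := by
    apply SimpleGraph.Dart.ext
    exact Prod.ext (R.fst_next d) hd
  exact R.rot_ne_self d.symm h h1

end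

end RotationSystem

/-! ### Boundary walks of short faces -/

namespace SurfaceEmbedding

section

variable {V : Type*} {G : SimpleGraph V} (M : SurfaceEmbedding G)

theorem face_next (d : G.Dart) : M.face (M.next d) = M.face d := by
  unfold face; rw [M.walkOf_next]

theorem face_rot (d : G.Dart) : M.face (M.rot d) = M.face d.symm := by
  rw [← M.face_next d.symm, M.next_eq, SimpleGraph.Dart.symm_symm]

/-- The corner between `rot.symm d` and `d` thus belongs to `face d`; corners are indexed by darts
in this way throughout. -/
theorem face_symm_rot_symm (d : G.Dart) : M.face (M.rot.symm d).symm = M.face d := by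
  rw [← M.face_next, M.next_symm_rot_symm]

theorem on_fst (d : G.Dart) : M.On d.fst (M.face d) :=
  ⟨_, Or.inl ⟨d, rfl, rfl⟩, rfl⟩

theorem on_snd (d : G.Dart) : M.On d.snd (M.face d) := by
  rw [← M.face_next, ← M.fst_next]; exact M.on_fst _

variable [Fintype V] [DecidableRel G.Adj]

open scoped Classical in
/-- The darts on the boundary of a face. -/
noncomputable def faceDarts (f : M.Face) : Finset G.Dart := {d | M.face d = f}

theorem mem_faceDarts {f : M.Face} {d : G.Dart} : d ∈ M.faceDarts f ↔ M.face d = f := by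
  simp [faceDarts]

theorem card_faceDarts (f : M.Face) : #(M.faceDarts f) = M.len f := by
  classical
  rw [len, Nat.card_eq_fintype_card, Fintype.card_subtype, faceDarts]

theorem exists_face_eq (hdeg : ∀ v, 0 < G.degree v) (f : M.Face) : ∃ d, M.face d = f := by
  obtain ⟨c | ⟨v, hv⟩, rfl⟩ := M.faceOfWalk_surjective f
  · induction c using Quotient.inductionOn with
    | h d => exact ⟨d, rfl⟩
  · obtain ⟨w, hw⟩ := (G.degree_pos_iff_exists_adj v).1 (hdeg v)
    exact absurd hw (hv w)

theorem next_next_ne (hdeg : ∀ v, 2 ≤ G.degree v) (d : G.Dart) : M.next (M.next d) ≠ d :=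
  fun h => M.fst_next_next_ne d (hdeg _) (by rw [h])

open scoped Classical in
theorem three_le_len (hdeg : ∀ v, 2 ≤ G.degree v) (f : M.Face) : 3 ≤ M.len f := by
  obtain ⟨d, rfl⟩ := M.exists_face_eq (fun v => by have := hdeg v; omega) f
  rw [← M.card_faceDarts]
  have h1 := M.next_ne_self d
  have h2 := M.next_ne_self (M.next d)
  have h3 := M.next_next_ne hdeg d
  calc 3 = #{d, M.next d, M.next (M.next d)} := by
        rw [Finset.card_eq_three.2 ⟨_, _, _, h1.symm, h3.symm, h2.symm, rfl⟩]
    _ ≤ _ := Finset.card_le_card (by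
        intro x hx
        simp only [Finset.mem_insert, Finset.mem_singleton] at hx
        rw [mem_faceDarts]
        rcases hx with rfl | rfl | rfl <;> simp only [face_next])

open scoped Classical in
theorem faceDarts_of_len_eq_three (hdeg : ∀ v, 2 ≤ G.degree v) (d : G.Dart)
    (h : M.len (M.face d) = 3) :
    M.faceDarts (M.face d) = {d, M.next d, M.next (M.next d)} := by
  have h1 := M.next_ne_self d
  have h2 := M.next_ne_self (M.next d)
  have h3 := M.next_next_ne hdeg d
  symm
  apply Finset.eq_of_subset_of_card_le
  · intro x hx
    simp only [Finset.mem_insert, Finset.mem_singleton] at hx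
    rw [mem_faceDarts]
    rcases hx with rfl | rfl | rfl <;> simp only [face_next]
  · rw [card_faceDarts, h, Finset.card_eq_three.2 ⟨_, _, _, h1.symm, h3.symm, h2.symm, rfl⟩]

theorem next_three (hdeg : ∀ v, 2 ≤ G.degree v) (d : G.Dart) (h : M.len (M.face d) = 3) :
    M.next (M.next (M.next d)) = d := by
  classical
  have h4 : M.next (M.next (M.next d)) ∈ M.faceDarts (M.face d) := by
    rw [mem_faceDarts]; simp only [face_next]
  rw [M.faceDarts_of_len_eq_three hdeg d h] at h4
  simp only [Finset.mem_insert, Finset.mem_singleton] at h4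
  rcases h4 with h4 | h4 | h4
  · exact h4
  · exact absurd h4 (M.next_next_ne hdeg _)
  · exact absurd h4 (M.next_ne_self _)

open scoped Classical in
theorem faceDarts_of_len_eq_four (hdeg : ∀ v, 2 ≤ G.degree v) (d : G.Dart)
    (h : M.len (M.face d) = 4) :
    M.faceDarts (M.face d) =
      {d, M.next d, M.next (M.next d), M.next (M.next (M.next d))} := by
  have h1 := M.next_ne_self d
  have h2 := M.next_ne_self (M.next d)
  have h3 := M.next_next_ne hdeg d
  have h4 := M.next_ne_self (M.next (M.next d))
  have h5 := M.next_next_ne hdeg (M.next d)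
  -- A 3-cycle of `next` would leave a single dart `y` on the face, and its successor could be
  -- neither `y` nor a dart of the cycle.
  have h6 : M.next (M.next (M.next d)) ≠ d := by
    intro hd
    obtain ⟨y, hy, hy'⟩ := Finset.exists_mem_notMem_of_card_lt_card
      (s := {d, M.next d, M.next (M.next d)}) (t := M.faceDarts (M.face d)) (by
        rw [card_faceDarts, h, Finset.card_eq_three.2 ⟨_, _, _, h1.symm, h3.symm, h2.symm, rfl⟩]
        norm_num)
    have hsub : insert y {d, M.next d, M.next (M.next d)} = M.faceDarts (M.face d) := by
      apply Finset.eq_of_subset_of_card_le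
      · intro x hx
        simp only [Finset.mem_insert, Finset.mem_singleton] at hx
        rcases hx with rfl | rfl | rfl | rfl
        · exact hy
        all_goals simp only [mem_faceDarts, face_next]
      · rw [card_faceDarts, h, Finset.card_insert_of_notMem hy',
          Finset.card_eq_three.2 ⟨_, _, _, h1.symm, h3.symm, h2.symm, rfl⟩]
    have hny : M.next y ∈ M.faceDarts (M.face d) := by
      rw [mem_faceDarts, face_next]; exact M.mem_faceDarts.1 hy
    rw [← hsub] at hny
    simp only [Finset.mem_insert, Finset.mem_singleton, not_or] at hny hy'
    rcases hny with e | e | e | e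
    · exact M.next_ne_self _ e
    · exact hy'.2.2 (M.next.injective (e.trans hd.symm))
    · exact hy'.1 (M.next.injective e)
    · exact hy'.2.1 (M.next.injective e)
  symm
  apply Finset.eq_of_subset_of_card_le
  · intro x hx
    simp only [Finset.mem_insert, Finset.mem_singleton] at hx
    rw [mem_faceDarts]
    rcases hx with rfl | rfl | rfl | rfl <;> simp only [face_next]
  · rw [card_faceDarts, h, Finset.card_insert_of_notMem,
      Finset.card_eq_three.2 ⟨_, _, _, h2.symm, h5.symm, h4.symm, rfl⟩]
    simp only [Finset.mem_insert, Finset.mem_singleton, not_or]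
    exact ⟨h1.symm, h3.symm, h6.symm⟩

/-- A face of length three or four visits each vertex at most once. -/
theorem eq_of_face_eq (hdeg : ∀ v, 2 ≤ G.degree v) {d e : G.Dart} (hf : M.face e = M.face d)
    (hfst : e.fst = d.fst) (h : M.len (M.face d) = 3 ∨ M.len (M.face d) = 4) : e = d := by
  classical
  have he : e ∈ M.faceDarts (M.face d) := M.mem_faceDarts.2 hf
  have h1 : (M.next d).fst ≠ d.fst := by rw [M.fst_next]; exact d.adj.ne'
  have h2 := M.fst_next_next_ne d (hdeg _)
  rcases h with h | h
  · rw [M.faceDarts_of_len_eq_three hdeg d h] at he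
    simp only [Finset.mem_insert, Finset.mem_singleton] at he
    rcases he with rfl | rfl | rfl
    · rfl
    · exact absurd hfst h1
    · exact absurd hfst h2
  · have h3 : M.next (M.next (M.next (M.next d))) ∈ M.faceDarts (M.face d) := by
      rw [mem_faceDarts]; simp only [face_next]
    rw [M.faceDarts_of_len_eq_four hdeg d h] at he h3
    simp only [Finset.mem_insert, Finset.mem_singleton] at he h3
    rcases he with rfl | rfl | rfl | rfl
    · rfl
    · exact absurd hfst h1
    · exact absurd hfst h2
    -- The dart in question is the third successor of `d`. If its own successor is `d`, it would be
    -- a loop; if that is `next d`, injectivity makes it `d`; the other cases break the rules on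
    -- fixed points and 2-cycles.
    · rcases h3 with h3 | h3 | h3 | h3
      · have := M.fst_next (M.next (M.next (M.next d)))
        rw [h3] at this
        exact absurd (hfst.trans this) (SimpleGraph.Dart.adj _).ne
      · have h3' := M.next.injective h3
        rw [h3']
      · exact absurd h3 (M.next_next_ne hdeg _)
      · exact absurd h3 (M.next_ne_self _)

/-- Otherwise `d.symm` and `next d` leave the same vertex on one triangle, so they coincide and the
walk turns back. -/
theorem face_ne_face_symm (hdeg : ∀ v, 2 ≤ G.degree v) (d : G.Dart)
    (h : M.len (M.face d) = 3) : M.face d ≠ M.face d.symm := by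
  intro hd
  have h1 := M.eq_of_face_eq hdeg (d := M.next d) (e := d.symm)
    (by rw [M.face_next, hd]) (by rw [M.fst_next]; rfl) (by rw [M.face_next]; exact Or.inl h)
  exact M.fst_next_next_ne d (hdeg _) (by rw [M.fst_next, ← h1]; rfl)

end

end SurfaceEmbedding

/-! ### Local structure when no configuration occurs -/

namespace SurfaceEmbedding

section

variable {V : Type*} {G : SimpleGraph V} (M : SurfaceEmbedding G) [Fintype V] [DecidableRel G.Adj]

/-- A face with a vertex of degree at most four. -/
def LowFace (f : M.Face) : Prop := ∃ d : G.Dart, M.face d = f ∧ G.degree d.fst ≤ 4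

variable {M}

section

variable (h : ¬ M.HasReducibleConfiguration)
include h

theorem three_le_degree (v : V) : 3 ≤ G.degree v := by
  by_contra hv
  exact h (.twoMinusVertex v (by omega))

theorem two_le_degree (v : V) : 2 ≤ G.degree v := by
  have := three_le_degree h v
  omega

theorem five_le_degree_of_adj_three {u v : V} (huv : G.Adj u v) (hu : G.degree u = 3) :
    5 ≤ G.degree v := by
  have := three_le_degree h v
  by_contra hv
  rcases (show G.degree v = 3 ∨ G.degree v = 4 by omega) with hv | hv
  · exact h (.adjacentThreeThree u v huv hu hv)
  · exact h (.adjacentThreeFour u v huv hu hv)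

/-- Of two vertices on a triangular face at least one has degree at least five. -/
theorem five_le_degree_fst_or_snd (d : G.Dart) (hd : M.len (M.face d) = 3) :
    5 ≤ G.degree d.fst ∨ 5 ≤ G.degree d.snd := by
  by_contra! hlt
  have h1 := three_le_degree h d.fst
  have h2 := three_le_degree h d.snd
  by_cases h3 : G.degree d.fst = 3
  · have := five_le_degree_of_adj_three h d.adj h3
    omega
  by_cases h4 : G.degree d.snd = 3
  · have := five_le_degree_of_adj_three h d.adj.symm h4
    omega
  exact h (.fourVerticesOnThreeFace _ d.fst d.snd hd d.adj.ne (M.on_fst d) (M.on_snd d)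
    (by omega) (by omega))

/-- These two heads are the ends of the side of the triangle opposite the tail of `d`. -/
theorem five_le_degree_snd_or (d : G.Dart) (hd : M.len (M.face d) = 3) :
    5 ≤ G.degree d.snd ∨ 5 ≤ G.degree (M.rot.symm d).snd := by
  have h1 : M.next (M.next d) = (M.rot.symm d).symm :=
    M.next.injective (by rw [M.next_three (two_le_degree h) d hd, M.next_symm_rot_symm])
  have h2 : (M.next d).snd = (M.rot.symm d).snd := by
    rw [← M.fst_next, h1]; rfl
  have h3 := five_le_degree_fst_or_snd h (M.next d) (by rwa [M.face_next])
  rwa [M.fst_next, h2] at h3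

/-- Two triangles do not share an edge that has an end of degree at most four. -/
theorem len_face_rot_ne_three (d : G.Dart) (hd : M.len (M.face d) = 3) (hs : G.degree d.snd ≤ 4) :
    M.len (M.face (M.rot d)) ≠ 3 := by
  intro h3
  rw [M.face_rot] at h3
  exact h (.adjacentThreeFaces d.symm (by
    rw [SimpleGraph.Dart.symm_symm]
    exact (M.face_ne_face_symm (two_le_degree h) d hd).symm) h3
    (by rwa [SimpleGraph.Dart.symm_symm]) hs)

theorem low_neighbor_of_lowFace (d : G.Dart) (hd : M.len (M.face d) = 3)
    (hv : 5 ≤ G.degree d.fst) (hl : M.LowFace (M.face d)) :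
    G.degree d.snd ≤ 4 ∨ G.degree (M.rot.symm d).snd ≤ 4 := by
  classical
  obtain ⟨e, he, hle⟩ := hl
  rw [← M.mem_faceDarts, M.faceDarts_of_len_eq_three (two_le_degree h) d hd] at he
  have h1 : M.next (M.next d) = (M.rot.symm d).symm :=
    M.next.injective (by rw [M.next_three (two_le_degree h) d hd, M.next_symm_rot_symm])
  simp only [Finset.mem_insert, Finset.mem_singleton] at he
  rcases he with rfl | rfl | rfl
  · omega
  · rw [M.fst_next] at hle
    exact Or.inl hle
  · rw [h1] at hle
    exact Or.inr hle

theorem rot_symm_snd_ne (d : G.Dart) : (M.rot.symm d).snd ≠ d.snd := by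
  intro hs
  have h1 : M.rot.symm d = d := SimpleGraph.Dart.ext _ _ (Prod.ext (M.fst_rot_symm d) hs)
  have h2 := M.rot_ne_self (M.rot.symm d) (two_le_degree h _)
  rw [Equiv.apply_symm_apply] at h2
  exact h2 h1.symm

/-- On a triangle the two 3-vertices would be adjacent, so the face has length four and contains
both. -/
theorem expensive_of_two_three_neighbors (d : G.Dart) (h1 : G.degree d.snd = 3)
    (h2 : G.degree (M.rot.symm d).snd = 3) (hlen : M.len (M.face d) < 5) :
    M.len (M.face d) = 4 ∧ M.Expensive (M.face d) := by
  have h3 := M.three_le_len (two_le_degree h) (M.face d)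
  have h4 : M.len (M.face d) ≠ 3 := fun h4 => by
    have := five_le_degree_snd_or h d h4
    omega
  have h5 : M.len (M.face d) = 4 := by omega
  refine ⟨h5, Or.inr ⟨h5, (M.rot.symm d).snd, d.snd, rot_symm_snd_ne h d, ?_, M.on_snd d, h2, h1⟩⟩
  rw [← M.face_symm_rot_symm]
  exact M.on_fst (M.rot.symm d).symm

/-- The corner between two neighbours of degree three, next to a triangle, belongs to a long
face. -/
theorem five_le_len_of_triangle (d : G.Dart) (h1 : G.degree d.snd = 3)
    (h2 : G.degree (M.rot.symm d).snd = 3)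
    (h3 : M.len (M.face (M.rot d)) = 3 ∨ M.len (M.face (M.rot.symm d)) = 3) :
    5 ≤ M.len (M.face d) := by
  by_contra! hlt
  obtain ⟨h4, h5⟩ := expensive_of_two_three_neighbors h d h1 h2 hlt
  rcases h3 with h3 | h3
  · rw [M.face_rot] at h3
    exact h (.threeAndFourFaces d.symm h3 (by rwa [SimpleGraph.Dart.symm_symm])
      (by rwa [SimpleGraph.Dart.symm_symm]))
  · rw [← M.face_symm_rot_symm] at h4 h5
    exact h (.threeAndFourFaces _ h3 h4 h5)

end

/-! ### Counting corners, and the discharging rules -/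

variable (M)

open scoped Classical in
/-- The darts leaving a vertex. -/
noncomputable def dartsAt (G : SimpleGraph V) [DecidableRel G.Adj] (v : V) : Finset G.Dart :=
  {d | d.fst = v}

theorem mem_dartsAt {v : V} {d : G.Dart} : d ∈ dartsAt G v ↔ d.fst = v := by
  simp [dartsAt]

theorem card_dartsAt (v : V) : #(dartsAt G v) = G.degree v := by
  classical
  rw [← SimpleGraph.dart_fst_fiber_card_eq_degree]
  congr 1

theorem sum_rot_symm (v : V) (g : G.Dart → ℤ) :
    ∑ d ∈ dartsAt G v, g (M.rot.symm d) = ∑ d ∈ dartsAt G v, g d :=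
  Finset.sum_equiv M.rot.symm (fun d => by rw [mem_dartsAt, mem_dartsAt, M.fst_rot_symm])
    fun _ _ => rfl

theorem sum_rot (v : V) (g : G.Dart → ℤ) :
    ∑ d ∈ dartsAt G v, g (M.rot d) = ∑ d ∈ dartsAt G v, g d :=
  Finset.sum_equiv M.rot (fun d => by rw [mem_dartsAt, mem_dartsAt, M.fst_rot])
    fun _ _ => rfl

open scoped Classical in
/-- The integer `1` if the proposition holds and `0` otherwise. -/
noncomputable def ind (p : Prop) : ℤ := if p then 1 else 0

theorem ind_of {p : Prop} (hp : p) : ind p = 1 := if_pos hp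

theorem ind_of_not {p : Prop} (hp : ¬ p) : ind p = 0 := if_neg hp

theorem ind_nonneg (p : Prop) : 0 ≤ ind p := by unfold ind; split_ifs <;> norm_num

theorem ind_le_one (p : Prop) : ind p ≤ 1 := by unfold ind; split_ifs <;> norm_num

/-- The number of darts leaving `v` that satisfy `P`. -/
noncomputable def count (G : SimpleGraph V) [DecidableRel G.Adj] (v : V) (P : G.Dart → Prop) : ℤ :=
  ∑ d ∈ dartsAt G v, ind (P d)

theorem count_true (v : V) : ∑ _d ∈ dartsAt G v, (1 : ℤ) = G.degree v := by
  rw [Finset.sum_const, card_dartsAt]; simp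

theorem count_nonneg (v : V) (P : G.Dart → Prop) : 0 ≤ count G v P :=
  Finset.sum_nonneg fun _ _ => ind_nonneg _

theorem count_le_degree (v : V) (P : G.Dart → Prop) : count G v P ≤ G.degree v := by
  rw [← count_true]
  exact Finset.sum_le_sum fun _ _ => ind_le_one _

theorem count_eq_card (v : V) (P : G.Dart → Prop) [DecidablePred P] :
    count G v P = #{d ∈ dartsAt G v | P d} := by
  rw [count, Finset.card_filter]
  push_cast
  exact Finset.sum_congr rfl fun d _ => by unfold ind; congr

theorem exists_of_count_pos {v : V} {P : G.Dart → Prop} (hP : 0 < count G v P) :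
    ∃ d : G.Dart, d.fst = v ∧ P d := by
  by_contra! hn
  refine hP.ne' (Finset.sum_eq_zero fun d hd => ind_of_not (hn d (mem_dartsAt.1 hd)))

/-- Corners at a vertex on short faces belong to different faces. -/
theorem count_face_le (h : ¬ M.HasReducibleConfiguration) (v : V) (P : M.Face → Prop)
    (hP : ∀ f, P f → M.len f = 3 ∨ M.len f = 4) :
    count G v (fun d => P (M.face d)) ≤ Nat.card {f : M.Face // M.On v f ∧ P f} := by
  classical
  rw [count_eq_card, Nat.card_eq_fintype_card, Fintype.card_subtype]
  norm_cast
  refine Finset.card_le_card_of_injOn M.face ?_ ?_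
  · intro d hd
    simp only [Finset.coe_filter, Set.mem_ofPred_eq, mem_dartsAt, Finset.mem_univ, true_and] at hd ⊢
    exact ⟨hd.1 ▸ M.on_fst d, hd.2⟩
  · intro d hd e he hde
    simp only [Finset.coe_filter, Set.mem_ofPred_eq, mem_dartsAt] at hd he
    exact M.eq_of_face_eq (two_le_degree h) hde (hd.1.trans he.1.symm) (hP _ he.2)

theorem count_three_neighbors (v : V) :
    count G v (fun d => G.degree d.snd = 3) = threeNeighbors G v := by
  classical
  rw [count_eq_card, threeNeighbors, Nat.card_eq_fintype_card, Fintype.card_subtype]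
  norm_cast
  refine Finset.card_bij (fun d _ => d.snd) ?_ ?_ ?_
  · intro d hd
    simp only [Finset.mem_filter, mem_dartsAt, Finset.mem_univ, true_and] at hd ⊢
    exact ⟨hd.1 ▸ d.adj, hd.2⟩
  · intro d hd e he hde
    simp only [Finset.mem_filter, mem_dartsAt] at hd he
    exact SimpleGraph.Dart.ext _ _ (Prod.ext (hd.1.trans he.1.symm) hde)
  · intro u hu
    simp only [Finset.mem_filter, Finset.mem_univ, true_and] at hu
    exact ⟨⟨(v, u), hu.1⟩, by simpa [mem_dartsAt] using hu.2, rfl⟩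

/-- The number of corners of a vertex that belong to long faces. -/
noncomputable def longCorners (v : V) : ℤ := count G v fun d => 5 ≤ M.len (M.face d)

/-- Six times the charge that the tail of a dart sends to the head. -/
noncomputable def toVertex (d : G.Dart) : ℤ :=
  if G.degree d.snd = 3 then max 0 (2 - M.longCorners d.snd) else 0

open scoped Classical in
/-- Six times the charge that the tail of a dart sends to the face of the dart. -/
noncomputable def toFace (d : G.Dart) : ℤ :=
  if M.len (M.face d) = 3 ∧ 5 ≤ G.degree d.fst then (if M.LowFace (M.face d) then 3 else 2) else 0

/-- Six times the charge that the face of a dart sends to the tail. -/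
noncomputable def fromFace (d : G.Dart) : ℤ :=
  if 5 ≤ M.len (M.face d) ∧ G.degree d.fst = 3 then 3 else 0

theorem toVertex_nonneg (d : G.Dart) : 0 ≤ M.toVertex d := by
  unfold toVertex; split_ifs <;> simp

theorem toVertex_eq_zero {d : G.Dart} (hd : G.degree d.snd ≠ 3) : M.toVertex d = 0 := if_neg hd

theorem toVertex_le_two (d : G.Dart) : M.toVertex d ≤ 2 := by
  have := count_nonneg d.snd fun d => 5 ≤ M.len (M.face d)
  unfold toVertex longCorners; split_ifs <;> omega

/-- Each long face at the edge of a dart lowers the charge sent along the dart. -/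
theorem toVertex_le (h : ¬ M.HasReducibleConfiguration) (d : G.Dart) (hd : G.degree d.snd = 3) :
    M.toVertex d ≤ 2 - ind (5 ≤ M.len (M.face d)) - ind (5 ≤ M.len (M.face (M.rot d))) := by
  classical
  have hne : d.symm ≠ M.next d := by
    intro hs
    exact M.rot_ne_self d.symm (two_le_degree h _) hs.symm
  -- The two sides of the edge give two different corners at the head, so both count in
  -- `longCorners`.
  have hsum : ind (5 ≤ M.len (M.face d.symm)) + ind (5 ≤ M.len (M.face (M.next d)))
      ≤ M.longCorners d.snd := by
    rw [longCorners, count, ← Finset.sum_pair (f := fun e => ind (5 ≤ M.len (M.face e))) hne]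
    refine Finset.sum_le_sum_of_subset_of_nonneg ?_ fun e _ _ => ind_nonneg _
    intro e he
    simp only [Finset.mem_insert, Finset.mem_singleton] at he
    rw [mem_dartsAt]
    rcases he with rfl | rfl
    · rfl
    · exact M.fst_next d
  rw [toVertex, if_pos hd, M.face_rot]
  rw [M.face_next] at hsum
  have h1 := ind_le_one (5 ≤ M.len (M.face d))
  have h2 := ind_le_one (5 ≤ M.len (M.face d.symm))
  omega

end

end SurfaceEmbedding

/-! ### Charge sent by a vertex of degree at least five -/

namespace SurfaceEmbedding

section

variable {V : Type*} {G : SimpleGraph V} (M : SurfaceEmbedding G) [Fintype V] [DecidableRel G.Adj]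

/-- The number of corners of a vertex that belong to triangles. -/
noncomputable def triangleCorners (v : V) : ℤ := count G v fun d => M.len (M.face d) = 3

/-- The number of corners of a vertex that belong to triangles with a vertex of degree at most
four. -/
noncomputable def lowTriangleCorners (v : V) : ℤ :=
  count G v fun d => M.len (M.face d) = 3 ∧ M.LowFace (M.face d)

/-- Six times the charge that a vertex sends to its neighbours. -/
noncomputable def sentToVertices (v : V) : ℤ := ∑ d ∈ dartsAt G v, M.toVertex d

theorem sum_toFace {v : V} (hv : 5 ≤ G.degree v) :
    ∑ d ∈ dartsAt G v, M.toFace d = 2 * M.triangleCorners v + M.lowTriangleCorners v := by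
  rw [triangleCorners, lowTriangleCorners, count, count, Finset.mul_sum, ← Finset.sum_add_distrib]
  refine Finset.sum_congr rfl fun d hd => ?_
  rw [mem_dartsAt] at hd
  subst hd
  unfold toFace ind
  by_cases h1 : M.len (M.face d) = 3 <;> by_cases h2 : M.LowFace (M.face d) <;> simp [h1, h2, hv]

variable {M} (h : ¬ M.HasReducibleConfiguration)
include h

omit h in
theorem sentToVertices_le_two_mul (v : V) : M.sentToVertices v ≤ 2 * threeNeighbors G v := by
  rw [← count_three_neighbors, sentToVertices, count, Finset.mul_sum]
  refine Finset.sum_le_sum fun d _ => ?_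
  by_cases hd : G.degree d.snd = 3
  · rw [ind_of hd]; exact M.toVertex_le_two d
  · rw [M.toVertex_eq_zero hd, ind_of_not hd]; norm_num

theorem count_expensive_le (v : V) :
    count G v (fun d => M.Expensive (M.face d)) ≤ M.expensiveFaces v :=
  count_face_le M h v _ fun _ hf => hf.imp And.left And.left

theorem triangleCorners_le (v : V) : M.triangleCorners v ≤ M.threeFaces v :=
  count_face_le M h v (fun f => M.len f = 3) fun _ hf => Or.inl hf

/-- With n the degree, k the number of 3-neighbours and m that of expensive faces, at least 2k − n
corners lie between consecutive 3-neighbours. All but m of them are on long faces, and each long one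
saves 1 on both of its edges: 2k − 2(2k − n − m) = 2n + 2m − 2k. -/
theorem sentToVertices_le_of_expensiveFaces (v : V) :
    M.sentToVertices v ≤
      2 * G.degree v + 2 * M.expensiveFaces v - 2 * threeNeighbors G v := by
  set A : G.Dart → ℤ := fun d => ind (G.degree d.snd = 3) with hA
  set L : G.Dart → ℤ := fun d => ind (G.degree d.snd = 3 ∧ G.degree (M.rot.symm d).snd = 3 ∧
    5 ≤ M.len (M.face d)) with hL
  have h1 : M.sentToVertices v ≤ ∑ d ∈ dartsAt G v, (2 * A d - L d - L (M.rot d)) := by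
    refine Finset.sum_le_sum fun d _ => ?_
    by_cases hd : G.degree d.snd = 3
    · have h2 := M.toVertex_le h d hd
      have h3 : L d ≤ ind (5 ≤ M.len (M.face d)) := by
        simp only [hL, ind]; split_ifs <;> simp_all
      have h4 : L (M.rot d) ≤ ind (5 ≤ M.len (M.face (M.rot d))) := by
        simp only [hL, ind]; split_ifs <;> simp_all
      have h5 : A d = 1 := ind_of hd
      linarith
    · rw [M.toVertex_eq_zero hd]
      have h6 : L (M.rot d) = 0 := ind_of_not fun h6 => hd (by
        rw [Equiv.symm_apply_apply] at h6; exact h6.2.1)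
      have h7 : L d = 0 := ind_of_not fun h7 => hd h7.1
      have h8 : A d = 0 := ind_of_not hd
      rw [h6, h7, h8]; norm_num
  -- A corner with 3-neighbours on both sides is long or expensive; at other corners the left side
  -- is at most 0.
  have h2 : ∑ d ∈ dartsAt G v, (A d + A (M.rot.symm d) - 1 - ind (M.Expensive (M.face d)))
      ≤ ∑ d ∈ dartsAt G v, L d := by
    refine Finset.sum_le_sum fun d _ => ?_
    by_cases h3 : G.degree d.snd = 3
    · by_cases h4 : G.degree (M.rot.symm d).snd = 3
      · by_cases h5 : 5 ≤ M.len (M.face d)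
        · have h6 : M.len (M.face d) ≠ 3 := by omega
          simp only [hA, hL, ind_of h3, ind_of h4, h3, h4, h5, and_self, ind_of trivial]
          have := ind_nonneg (M.Expensive (M.face d))
          linarith
        · have h6 := (expensive_of_two_three_neighbors h d h3 h4 (by omega)).2
          simp [hA, hL, ind, h3, h4, h5, h6]
      · have := ind_nonneg (M.Expensive (M.face d))
        simp only [hA, hL, ind_of h3, ind_of_not h4, h4, false_and, and_false,
          ind_of_not not_false]
        linarith
    · have := ind_nonneg (M.Expensive (M.face d))
      have := ind_le_one (G.degree (M.rot.symm d).snd = 3)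
      simp only [hA, hL, ind_of_not h3, h3, false_and, ind_of_not not_false]
      linarith
  rw [Finset.sum_sub_distrib, Finset.sum_sub_distrib, M.sum_rot v L, ← Finset.mul_sum] at h1
  rw [Finset.sum_sub_distrib, Finset.sum_sub_distrib, Finset.sum_add_distrib,
    M.sum_rot_symm v A, count_true] at h2
  have h3 := count_expensive_le h v
  have h4 : ∑ d ∈ dartsAt G v, A d = threeNeighbors G v := count_three_neighbors v
  unfold count at h3
  linarith

/-- The charge that a vertex sends to its neighbours can be distributed to its corners outside
triangles. -/
theorem sentToVertices_le_of_triangleCorners (v : V) :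
    M.sentToVertices v ≤ 2 * (G.degree v - M.triangleCorners v) := by
  classical
  set c : G.Dart → ℤ := M.toVertex with hc
  set T : G.Dart → Prop := fun d => M.len (M.face d) = 3 with hT
  -- Twice the charge along `d` is split between its two corners: `x d` goes to the corner of `d`,
  -- the rest to that of `rot d`. A triangle gets nothing unless both corners are triangles, and
  -- then the charge is 0.
  set x : G.Dart → ℤ := fun d => if T d then 0 else if T (M.rot d) then 2 * c d else c d with hx
  have hsum : ∑ d ∈ dartsAt G v, (x d + (2 * c (M.rot.symm d) - x (M.rot.symm d)))
      = 2 * M.sentToVertices v := by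
    rw [Finset.sum_add_distrib, M.sum_rot_symm v fun d => 2 * c d - x d, ← Finset.sum_add_distrib,
      sentToVertices, Finset.mul_sum]
    exact Finset.sum_congr rfl fun d _ => by simp only [hc]; ring
  have hle : ∑ d ∈ dartsAt G v, (x d + (2 * c (M.rot.symm d) - x (M.rot.symm d)))
      ≤ ∑ d ∈ dartsAt G v, 4 * (1 - ind (T d)) := by
    refine Finset.sum_le_sum fun d _ => ?_
    set e := M.rot.symm d with he
    have hre : M.rot e = d := Equiv.apply_symm_apply _ _
    have c1 := M.toVertex_le_two d
    have c2 := M.toVertex_le_two e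
    have c3 := M.toVertex_nonneg d
    have c4 := M.toVertex_nonneg e
    have hz : ∀ d, T d → T (M.rot d) → c d = 0 := fun d h1 h2 => by
      by_cases h3 : G.degree d.snd = 3
      · exact absurd h2 (len_face_rot_ne_three h d h1 (by omega))
      · exact M.toVertex_eq_zero h3
    by_cases hd : T d
    · by_cases h2 : T e
      · have := hz e h2 (by rwa [hre])
        simp [hx, hd, h2, ind, this]
      · simp [hx, hd, h2, ind, hre]
    · rw [ind_of_not hd]
      have hx1 : x d ≤ 2 * c d := by
        simp only [hx]; split_ifs <;> linarith
      have hx2 : 0 ≤ x e := by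
        simp only [hx]; split_ifs <;> linarith
      by_cases h3 : G.degree d.snd = 3
      · by_cases h4 : G.degree e.snd = 3
        -- Next to a triangle this corner is long, so both charges are at most 1 and may go here in
        -- full; otherwise each of them gives only half.
        · by_cases h5 : T (M.rot d) ∨ T e
          · have hl := five_le_len_of_triangle h d h3 h4 h5
            have c5 := M.toVertex_le h d h3
            have c6 := M.toVertex_le h e h4
            rw [hre, ind_of hl] at c6
            rw [ind_of hl] at c5
            have := ind_nonneg (5 ≤ M.len (M.face e))
            have := ind_nonneg (5 ≤ M.len (M.face (M.rot d)))
            simp only [hc] at hx1 hx2 ⊢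
            linarith
          · push Not at h5
            simp only [hx, hd, h5.1, h5.2, hre, if_false, hc]
            linarith
        · have : c e = 0 := M.toVertex_eq_zero h4
          simp only [hc] at hx1 this ⊢
          linarith
      · have : c d = 0 := M.toVertex_eq_zero h3
        simp only [hc] at hx1 hx2 this ⊢
        linarith
  rw [hsum, ← Finset.mul_sum, Finset.sum_sub_distrib, count_true] at hle
  change _ ≤ 4 * (_ - M.triangleCorners v) at hle
  linarith

omit h in
theorem lowTriangleCorners_le (v : V) : M.lowTriangleCorners v ≤ M.triangleCorners v := by
  refine Finset.sum_le_sum fun d _ => ?_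
  by_cases h1 : M.len (M.face d) = 3
  · rw [ind_of h1]; exact ind_le_one _
  · rw [ind_of_not h1, ind_of_not fun h2 => h1 h2.1]

/-- Across the edge to a low neighbour such a triangle meets a corner outside triangles, and each of
those corners is met from at most two sides. -/
theorem lowTriangleCorners_le_two_mul {v : V} (hv : 5 ≤ G.degree v) :
    M.lowTriangleCorners v ≤ 2 * (G.degree v - M.triangleCorners v) := by
  set N : G.Dart → ℤ := fun d => 1 - ind (M.len (M.face d) = 3) with hN
  have hle : M.lowTriangleCorners v ≤ ∑ d ∈ dartsAt G v, (N (M.rot d) + N (M.rot.symm d)) := by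
    refine Finset.sum_le_sum fun d hd => ?_
    rw [mem_dartsAt] at hd
    subst hd
    have hN0 : ∀ d, 0 ≤ N d := fun d => by
      have := ind_le_one (M.len (M.face d) = 3)
      simp only [hN]; linarith
    by_cases h1 : M.len (M.face d) = 3 ∧ M.LowFace (M.face d)
    · rw [ind_of h1]
      rcases low_neighbor_of_lowFace h d h1.1 hv h1.2 with h2 | h2
      · have := len_face_rot_ne_three h d h1.1 h2
        have h3 : N (M.rot d) = 1 := by simp only [hN]; rw [ind_of_not this]; rfl
        have := hN0 (M.rot.symm d)
        linarith
      · have h3 : M.len (M.face (M.rot.symm d)) ≠ 3 := fun h3 => by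
          have := len_face_rot_ne_three h _ h3 h2
          rw [Equiv.apply_symm_apply] at this
          exact this h1.1
        have h4 : N (M.rot.symm d) = 1 := by simp only [hN]; rw [ind_of_not h3]; rfl
        have := hN0 (M.rot d)
        linarith
    · rw [ind_of_not h1]
      have := hN0 (M.rot d)
      have := hN0 (M.rot.symm d)
      linarith
  rw [Finset.sum_add_distrib, M.sum_rot, M.sum_rot_symm, Finset.sum_sub_distrib, count_true] at hle
  change _ ≤ _ - M.triangleCorners v + (_ - M.triangleCorners v) at hle
  linarith

/-- If a vertex is on a triangle, then one of its neighbours has degree at least five, and its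
triangles with a low vertex are expensive or use up a neighbour of degree four. -/
theorem lowTriangleCorners_add_le {v : V} (hv : 5 ≤ G.degree v) (ht : 0 < M.triangleCorners v) :
    threeNeighbors G v < G.degree v ∧
      M.lowTriangleCorners v + threeNeighbors G v < M.expensiveFaces v + G.degree v := by
  set T : G.Dart → ℤ := fun d => ind (M.len (M.face d) = 3) with hT
  set B : G.Dart → ℤ := fun d => ind (G.degree d.snd = 4) with hB
  have hB0 : ∀ d, 0 ≤ B d := fun d => ind_nonneg _
  have hT0 : ∀ d, 0 ≤ T d := fun d => ind_nonneg _
  have h1 : M.lowTriangleCorners v ≤ ∑ d ∈ dartsAt G v,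
      (ind (M.Expensive (M.face d)) + B d * T d + B (M.rot.symm d) * T d) := by
    refine Finset.sum_le_sum fun d hd => ?_
    rw [mem_dartsAt] at hd
    subst hd
    have e0 := ind_nonneg (M.Expensive (M.face d))
    have e1 := mul_nonneg (hB0 d) (hT0 d)
    have e2 := mul_nonneg (hB0 (M.rot.symm d)) (hT0 d)
    by_cases h1 : M.len (M.face d) = 3 ∧ M.LowFace (M.face d)
    · have hT1 : T d = 1 := ind_of h1.1
      have key : ∀ e : G.Dart, G.degree e.snd ≤ 4 → M.On e.snd (M.face d) →
          M.Expensive (M.face d) ∨ G.degree e.snd = 4 := fun e he ho => by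
        have := three_le_degree h e.snd
        by_cases h4 : G.degree e.snd = 4
        · exact Or.inr h4
        · exact Or.inl (Or.inl ⟨h1.1, e.snd, ho, by omega⟩)
      rw [ind_of h1]
      rcases low_neighbor_of_lowFace h d h1.1 hv h1.2 with h2 | h2
      · rcases key d h2 (M.on_snd d) with h3 | h3
        · rw [ind_of h3]; linarith
        · have : B d = 1 := ind_of h3
          rw [hT1] at e1 e2 ⊢
          rw [this]
          linarith
      · rcases key _ h2 (by
          rw [← M.face_symm_rot_symm]
          exact M.on_fst (M.rot.symm d).symm) with h3 | h3
        · rw [ind_of h3]; linarith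
        · have : B (M.rot.symm d) = 1 := ind_of h3
          rw [hT1] at e1 e2 ⊢
          rw [this]
          linarith
    · rw [ind_of_not h1]; linarith
  -- The edge to a 4-neighbour borders at most one triangle.
  have h2 : ∑ d ∈ dartsAt G v, (B d * T d + B d * T (M.rot d)) ≤ ∑ d ∈ dartsAt G v, B d := by
    refine Finset.sum_le_sum fun d _ => ?_
    by_cases hd : G.degree d.snd = 4
    · have hB1 : B d = 1 := ind_of hd
      have : T d + T (M.rot d) ≤ 1 := by
        by_cases h3 : M.len (M.face d) = 3
        · have h4 := len_face_rot_ne_three h d h3 (by omega)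
          simp only [hT, ind_of h3, ind_of_not h4]; norm_num
        · simp only [hT, ind_of_not h3]
          have := ind_le_one (M.len (M.face (M.rot d)) = 3)
          linarith
      rw [hB1]; linarith
    · have : B d = 0 := ind_of_not hd
      rw [this]; norm_num
  -- The side opposite `v` in a triangle has an end of degree at least five, which is neither a 3-
  -- nor a 4-neighbour.
  have h3 : ∑ d ∈ dartsAt G v, (B d + ind (G.degree d.snd = 3)) + 1 ≤ G.degree v := by
    obtain ⟨d, hd, hlen⟩ := exists_of_count_pos ht
    obtain ⟨e, he, h5⟩ : ∃ e : G.Dart, e.fst = v ∧ 5 ≤ G.degree e.snd := by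
      rcases five_le_degree_snd_or h d hlen with h5 | h5
      · exact ⟨d, hd, h5⟩
      · exact ⟨_, (M.fst_rot_symm d).trans hd, h5⟩
    have hs : ∑ d ∈ dartsAt G v, (1 - B d - ind (G.degree d.snd = 3)) ≥ 1 := by
      calc (1 : ℤ) = 1 - B e - ind (G.degree e.snd = 3) := by
            simp only [hB]
            rw [ind_of_not (by omega), ind_of_not (by omega)]; norm_num
        _ ≤ _ := Finset.single_le_sum (f := fun d => 1 - B d - ind (G.degree d.snd = 3))
            (fun d _ => by
              simp only [hB]
              by_cases hd : G.degree d.snd = 3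
              · rw [ind_of hd, ind_of_not (by omega)]; norm_num
              · rw [ind_of_not hd]
                have := ind_le_one (G.degree d.snd = 4)
                linarith) (mem_dartsAt.2 he)
    rw [Finset.sum_sub_distrib, Finset.sum_sub_distrib, count_true] at hs
    rw [Finset.sum_add_distrib]
    linarith
  have h4 : ∑ d ∈ dartsAt G v, B (M.rot.symm d) * T d
      = ∑ d ∈ dartsAt G v, B d * T (M.rot d) := by
    rw [← M.sum_rot_symm v fun d => B d * T (M.rot d)]
    simp only [Equiv.apply_symm_apply]
  rw [Finset.sum_add_distrib, Finset.sum_add_distrib, h4] at h1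
  rw [Finset.sum_add_distrib] at h2 h3
  have h5 := count_expensive_le h v
  have h6 : ∑ d ∈ dartsAt G v, ind (G.degree d.snd = 3) = threeNeighbors G v :=
    count_three_neighbors v
  have h7 : 0 ≤ ∑ d ∈ dartsAt G v, B d := Finset.sum_nonneg fun d _ => hB0 d
  unfold count at h5
  constructor <;> linarith

/-- With 3-neighbours excluded, a low vertex on a triangle at `v` is a 4-vertex and makes the
triangle costly. -/
theorem threeNeighbors_eq_zero {v : V} (hv : G.degree v = 5 ∨ G.degree v = 6)
    (ht : 2 ≤ M.triangleCorners v) : threeNeighbors G v = 0 ∧ M.lowTriangleCorners v = 0 := by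
  have ht' := triangleCorners_le h v
  have ht2 : 2 ≤ M.threeFaces v := by omega
  have hA : ∀ d : G.Dart, d.fst = v → G.degree d.snd ≠ 3 := fun d hd h3 =>
    h (.threeFacesAndThreeNeighbor d.snd v hv ht2 (hd ▸ d.adj) h3)
  constructor
  · have : count G v (fun d => G.degree d.snd = 3) = 0 :=
      Finset.sum_eq_zero fun d hd => ind_of_not (hA d (mem_dartsAt.1 hd))
    rw [count_three_neighbors] at this
    exact_mod_cast this
  · refine Finset.sum_eq_zero fun d hd => ind_of_not fun h1 => ?_
    rw [mem_dartsAt] at hd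
    subst hd
    have key : ∀ e : G.Dart, e.fst = d.fst → M.On e.snd (M.face d) → ¬ G.degree e.snd ≤ 4 :=
      fun e he ho hle => by
        have := three_le_degree h e.snd
        have := hA e he
        exact h (.threeFacesAndCostly d.fst (M.face d) hv ht2 (M.on_fst d)
          ⟨h1.1, e.snd, ho, by omega⟩)
    rcases low_neighbor_of_lowFace h d h1.1 (by omega) h1.2 with h2 | h2
    · exact key d rfl (M.on_snd d) h2
    · refine key _ (M.fst_rot_symm d) ?_ h2
      rw [← M.face_symm_rot_symm]
      exact M.on_fst (M.rot.symm d).symm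

/-- A vertex of degree at least five keeps a positive charge. -/
theorem sent_lt {v : V} (hv : 5 ≤ G.degree v) :
    M.sentToVertices v + 2 * M.triangleCorners v + M.lowTriangleCorners v
      < 6 * ((G.degree v : ℤ) - 4) := by
  have c1 := sentToVertices_le_two_mul (M := M) v
  have c2 := sentToVertices_le_of_expensiveFaces h v
  have c3 := sentToVertices_le_of_triangleCorners h v
  have h1 := M.lowTriangleCorners_le v
  have h2 := lowTriangleCorners_le_two_mul h hv
  have h3 := fun ht => lowTriangleCorners_add_le h hv ht
  have h4 := fun hd ht => threeNeighbors_eq_zero h (v := v) hd ht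
  have t0 : 0 ≤ M.triangleCorners v := count_nonneg _ _
  have t1 := triangleCorners_le h v
  have k1 := count_le_degree v fun d : G.Dart => G.degree d.snd = 3
  rw [count_three_neighbors] at k1
  have x1 : ¬ ExcludedTriple _ _ _ := fun hx => h (.threeNeighborsAndExpensiveFaces v hx)
  have x5 : ¬ (G.degree v = 5 ∧ 3 ≤ M.threeFaces v) := fun hx => h (.fiveVertex v hx.1 hx.2)
  have x6 : ¬ (G.degree v = 6 ∧ 5 ≤ M.threeFaces v) := fun hx => h (.sixVertex v hx.1 hx.2)
  unfold ExcludedTriple at x1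
  generalize G.degree v = n at *
  generalize threeNeighbors G v = k at *
  generalize M.expensiveFaces v = m at *
  generalize M.threeFaces v = t' at *
  generalize M.triangleCorners v = t at *
  generalize M.lowTriangleCorners v = l at *
  generalize M.sentToVertices v = C at *
  clear h
  rcases (show n = 5 ∨ n = 6 ∨ n = 7 ∨ 8 ≤ n by omega) with rfl | rfl | rfl | hn
  -- The budget is 6. Two triangles cost 2 each and nothing else is sent. Otherwise a triangle costs
  -- at most 3, and at most 2 goes to neighbours: k ≤ 1, or k = 5 and m = 0.
  · by_cases ht : 2 ≤ t
    · obtain ⟨rfl, rfl⟩ := h4 (by omega) ht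
      clear x1
      omega
    · clear h3 h4 x5 x6
      have hk : k ≤ 5 := by omega
      interval_cases k <;> simp at x1 <;> omega
  · by_cases ht : 2 ≤ t
    · obtain ⟨rfl, rfl⟩ := h4 (by omega) ht
      clear x1
      omega
    · clear h3 h4 x5 x6
      have hk : k ≤ 6 := by omega
      interval_cases k <;> simp at x1 <;> omega
  · clear h4 x5 x6
    by_cases ht : 0 < t
    · have h3 := h3 ht
      have h5 := h3.2
      have hk : k < 7 := h3.1
      interval_cases k <;> simp at x1 <;> omega
    · clear h3 x1
      omega
  · clear h3 h4 x1 x5 x6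
    -- Here C + 2t ≤ 2n and 3l ≤ 2n, which suffices from n = 8 on.
    omega

end

end SurfaceEmbedding

/-! ### Total charge and final charges -/

namespace SurfaceEmbedding

section

variable {V : Type*} {G : SimpleGraph V} (M : SurfaceEmbedding G) [Fintype V] [DecidableRel G.Adj]

/-- Six times the final charge of a vertex. -/
noncomputable def vertexCharge (v : V) : ℤ :=
  6 * ((G.degree v : ℤ) - 4) +
    ∑ d ∈ dartsAt G v, (M.fromFace d - M.toFace d - M.toVertex d + M.toVertex d.symm)

/-- Six times the final charge of a face. -/
noncomputable def faceCharge (f : M.Face) : ℤ :=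
  6 * ((M.len f : ℤ) - 4) + ∑ d ∈ M.faceDarts f, (M.toFace d - M.fromFace d)

theorem sum_dartsAt (g : G.Dart → ℤ) : ∑ v, ∑ d ∈ dartsAt G v, g d = ∑ d, g d := by
  classical
  rw [← Finset.sum_fiberwise (s := Finset.univ) (g := fun d : G.Dart => d.fst)]
  refine Finset.sum_congr rfl fun v _ => Finset.sum_congr ?_ fun _ _ => rfl
  ext d
  simp [mem_dartsAt]

theorem sum_faceDarts (g : G.Dart → ℤ) : ∑ f, ∑ d ∈ M.faceDarts f, g d = ∑ d, g d := by
  classical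
  rw [← Finset.sum_fiberwise (s := Finset.univ) (g := M.face)]
  refine Finset.sum_congr rfl fun v _ => Finset.sum_congr ?_ fun _ _ => rfl
  ext d
  simp [mem_faceDarts]

/-- Having at least one boundary walk, a face contributes at most 1 to the Euler characteristic;
genus and further walks only lower this. -/
theorem card_edgeSet_le :
    (Nat.card G.edgeSet : ℤ) ≤ Nat.card V + Fintype.card M.Face - M.eulerChar := by
  have hle : ∑ f : M.Face, (2 - 2 * (M.genus f : ℤ) - Nat.card {c // M.faceOfWalk c = f})
      ≤ ∑ _f : M.Face, (1 : ℤ) := by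
    refine Finset.sum_le_sum fun f _ => ?_
    obtain ⟨c, hc⟩ := M.faceOfWalk_surjective f
    have : Nonempty {c // M.faceOfWalk c = f} := ⟨⟨c, hc⟩⟩
    have : 0 < Nat.card {c // M.faceOfWalk c = f} := Nat.card_pos
    omega
  rw [eulerChar]
  simp only [Finset.sum_const, Finset.card_univ, nsmul_eq_mul, mul_one] at hle
  linarith

theorem sum_charge_le (hM : M.IsToroidal) :
    ∑ v, M.vertexCharge v + ∑ f, M.faceCharge f ≤ 0 := by
  classical
  have h1 := M.card_edgeSet_le
  rw [hM, Nat.card_eq_fintype_card, Nat.card_eq_fintype_card] at h1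
  have h2 : ∑ v, (G.degree v : ℤ) = 2 * Fintype.card G.edgeSet := by
    rw [← SimpleGraph.edgeFinset_card]
    exact_mod_cast G.sum_degrees_eq_twice_card_edges
  have h3 : ∑ f, (M.len f : ℤ) = 2 * Fintype.card G.edgeSet := by
    rw [← h2]
    have h4 := M.sum_faceDarts fun _ => 1
    rw [← sum_dartsAt] at h4
    simpa only [Finset.sum_const, card_faceDarts, card_dartsAt, nsmul_eq_mul, mul_one] using h4
  have h5 : ∑ d : G.Dart, M.toVertex d.symm = ∑ d, M.toVertex d :=
    Equiv.sum_comp (SimpleGraph.Dart.symm_involutive (G := G)).toPerm M.toVertex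
  simp only [vertexCharge, faceCharge, Finset.sum_add_distrib, ← Finset.mul_sum,
    Finset.sum_sub_distrib, sum_dartsAt, sum_faceDarts, h2, h3, h5, Finset.sum_const,
    Finset.card_univ, nsmul_eq_mul]
  linarith

variable {M}

theorem fromFace_of_degree_ne {d : G.Dart} (hd : G.degree d.fst ≠ 3) : M.fromFace d = 0 :=
  if_neg fun h => hd h.2

theorem toFace_of_degree_lt {d : G.Dart} (hd : G.degree d.fst < 5) : M.toFace d = 0 :=
  if_neg fun h => hd.not_ge h.2

variable (h : ¬ M.HasReducibleConfiguration)
include h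

/-- With L long corners, the initial −6 is repaid by 3L from faces and 3 max(0, 2 − L) from the
neighbours. -/
theorem vertexCharge_nonneg_of_three {v : V} (hv : G.degree v = 3) : 0 ≤ M.vertexCharge v := by
  have hs : ∑ d ∈ dartsAt G v, (M.fromFace d - M.toFace d - M.toVertex d + M.toVertex d.symm)
      = ∑ d ∈ dartsAt G v, (3 * ind (5 ≤ M.len (M.face d)) + max 0 (2 - M.longCorners v)) := by
    refine Finset.sum_congr rfl fun d hd => ?_
    rw [mem_dartsAt] at hd
    subst hd
    have h1 := five_le_degree_of_adj_three h d.adj hv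
    rw [toFace_of_degree_lt (by omega), M.toVertex_eq_zero (d := d) (by omega), fromFace, toVertex,
      if_pos (show G.degree d.symm.snd = 3 from hv)]
    by_cases h2 : 5 ≤ M.len (M.face d)
    · rw [if_pos ⟨h2, hv⟩, ind_of h2]
      simp
    · rw [if_neg (fun h3 => h2 h3.1), ind_of_not h2]
      simp
  rw [vertexCharge, hs, Finset.sum_add_distrib, ← Finset.mul_sum, Finset.sum_const, card_dartsAt, hv]
  change 0 ≤ _ + (3 * M.longCorners v + _)
  rw [nsmul_eq_mul]
  push_cast
  omega

theorem vertexCharge_of_four {v : V} (hv : G.degree v = 4) : M.vertexCharge v = 0 := by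
  rw [vertexCharge, hv, Finset.sum_eq_zero]
  · norm_num
  intro d hd
  rw [mem_dartsAt] at hd
  subst hd
  have h1 : G.degree d.snd ≠ 3 := fun h3 => by
    have := five_le_degree_of_adj_three h d.adj.symm h3
    omega
  rw [toFace_of_degree_lt (by omega), M.toVertex_eq_zero h1, fromFace_of_degree_ne (by omega),
    M.toVertex_eq_zero (show G.degree d.symm.snd ≠ 3 by
      change G.degree d.fst ≠ 3
      omega)]
  norm_num

theorem vertexCharge_pos {v : V} (hv : 5 ≤ G.degree v) : 0 < M.vertexCharge v := by
  have hs : ∑ d ∈ dartsAt G v, (M.fromFace d - M.toFace d - M.toVertex d + M.toVertex d.symm)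
      = ∑ d ∈ dartsAt G v, (-M.toFace d - M.toVertex d) := by
    refine Finset.sum_congr rfl fun d hd => ?_
    rw [mem_dartsAt] at hd
    subst hd
    rw [fromFace_of_degree_ne (by omega), M.toVertex_eq_zero (show G.degree d.symm.snd ≠ 3 by
      change G.degree d.fst ≠ 3
      omega)]
    ring
  have h1 := sent_lt h hv
  rw [vertexCharge, hs, Finset.sum_sub_distrib, Finset.sum_neg_distrib, M.sum_toFace hv]
  change 0 < _ + (_ - M.sentToVertices v)
  linarith

theorem vertexCharge_nonneg (v : V) : 0 ≤ M.vertexCharge v := by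
  have := three_le_degree h v
  rcases (show G.degree v = 3 ∨ G.degree v = 4 ∨ 5 ≤ G.degree v by omega) with hv | hv | hv
  · exact vertexCharge_nonneg_of_three h hv
  · exact (vertexCharge_of_four h hv).ge
  · exact (vertexCharge_pos h hv).le

/-- At most half of the corners of a face are at vertices of degree three. -/
theorem two_mul_sum_three_le (f : M.Face) :
    2 * ∑ d ∈ M.faceDarts f, ind (G.degree d.fst = 3) ≤ M.len f := by
  have h1 : ∑ d ∈ M.faceDarts f, ind (G.degree (M.next d).fst = 3)
      = ∑ d ∈ M.faceDarts f, ind (G.degree d.fst = 3) :=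
    Finset.sum_equiv M.next (fun d => by rw [mem_faceDarts, mem_faceDarts, M.face_next])
      fun _ _ => rfl
  have h2 : ∑ d ∈ M.faceDarts f, (ind (G.degree d.fst = 3) + ind (G.degree (M.next d).fst = 3))
      ≤ ∑ _d ∈ M.faceDarts f, (1 : ℤ) := by
    refine Finset.sum_le_sum fun d _ => ?_
    rw [M.fst_next]
    by_cases h3 : G.degree d.fst = 3
    · have := five_le_degree_of_adj_three h d.adj h3
      rw [ind_of h3, ind_of_not (by omega)]; norm_num
    · rw [ind_of_not h3, zero_add]; exact ind_le_one _
  rw [Finset.sum_add_distrib, h1, Finset.sum_const, card_faceDarts] at h2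
  simp only [nsmul_eq_mul, mul_one] at h2
  linarith

omit h in
theorem faceCharge_of_five_le {f : M.Face} (hf : 5 ≤ M.len f) :
    M.faceCharge f = 6 * ((M.len f : ℤ) - 4) -
      3 * ∑ d ∈ M.faceDarts f, ind (G.degree d.fst = 3) := by
  rw [faceCharge, Finset.mul_sum, sub_eq_add_neg _ (∑ d ∈ _, _), ← Finset.sum_neg_distrib]
  congr 1
  refine Finset.sum_congr rfl fun d hd => ?_
  rw [mem_faceDarts] at hd
  subst hd
  rw [toFace, if_neg (by omega), fromFace]
  by_cases h1 : G.degree d.fst = 3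
  · rw [if_pos ⟨hf, h1⟩, ind_of h1]; norm_num
  · rw [if_neg (fun h2 => h1 h2.2), ind_of_not h1]; norm_num

/-- The deficit of 6 is met by 2 from each of three vertices, or, on a low triangle, by 3 from each
of at least two, since every side has an end of degree at least five. -/
theorem faceCharge_nonneg_of_three {f : M.Face} (hf : M.len f = 3) : 0 ≤ M.faceCharge f := by
  classical
  have hdeg := two_le_degree h
  obtain ⟨d, rfl⟩ := M.exists_face_eq (fun v => by have := hdeg v; omega) f
  have h1 := M.next_ne_self d
  have h2 := M.next_ne_self (M.next d)
  have h3 := M.next_next_ne hdeg d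
  have f1 := M.face_next d
  have f2 := (M.face_next (M.next d)).trans f1
  have a1 := five_le_degree_fst_or_snd h d hf
  have a2 := five_le_degree_fst_or_snd h (M.next d) (by rwa [f1])
  have a3 := five_le_degree_fst_or_snd h (M.next (M.next d)) (by rwa [f2])
  rw [← M.fst_next] at a1 a2 a3
  rw [M.next_three hdeg d hf] at a3
  have hp : ∀ e : G.Dart, M.face e = M.face d → M.fromFace e = 0 := fun e he =>
    if_neg fun h5 => by rw [he] at h5; omega
  rw [faceCharge, hf, M.faceDarts_of_len_eq_three hdeg d hf,
    Finset.sum_insert (by simp [h1.symm, h3.symm]), Finset.sum_insert (by simp [h2.symm]),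
    Finset.sum_singleton, hp d rfl, hp _ f1, hp _ f2]
  by_cases hl : M.LowFace (M.face d)
  · have hq : ∀ e : G.Dart, M.face e = M.face d → 5 ≤ G.degree e.fst → M.toFace e = 3 :=
      fun e he h5 => by
        rw [← he] at hf hl
        rw [toFace, if_pos ⟨hf, h5⟩, if_pos hl]
    have hq0 : ∀ e : G.Dart, 0 ≤ M.toFace e := fun e => by
      unfold toFace; split_ifs <;> norm_num
    have q1 := hq d rfl
    have q2 := hq _ f1
    have q3 := hq _ f2
    have p1 := hq0 d
    have p2 := hq0 (M.next d)
    have p3 := hq0 (M.next (M.next d))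
    rcases a1 with a1 | a1
    · rcases a2 with a2 | a2
      · rw [q1 a1, q2 a2]; push_cast; linarith
      · rw [q1 a1, q3 a2]; push_cast; linarith
    · rcases a3 with a3 | a3
      · rw [q2 a1, q3 a3]; push_cast; linarith
      · rw [q2 a1, q1 a3]; push_cast; linarith
  · have hq : ∀ e : G.Dart, M.face e = M.face d → M.toFace e = 2 := fun e he => by
      have h5 : 5 ≤ G.degree e.fst := by
        by_contra hlt
        exact hl ⟨e, he, by omega⟩
      rw [← he] at hf hl
      rw [toFace, if_pos ⟨hf, h5⟩, if_neg hl]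
    rw [hq d rfl, hq _ f1, hq _ f2]
    norm_num

theorem faceCharge_nonneg (f : M.Face) : 0 ≤ M.faceCharge f := by
  have hlen := M.three_le_len (two_le_degree h) f
  rcases (show M.len f = 3 ∨ M.len f = 4 ∨ 5 ≤ M.len f by omega) with hf | hf | hf
  · exact faceCharge_nonneg_of_three h hf
  · rw [faceCharge, hf, Finset.sum_eq_zero]
    · norm_num
    intro d hd
    rw [mem_faceDarts] at hd
    subst hd
    rw [toFace, if_neg (by omega), fromFace, if_neg (by omega)]
    norm_num
  -- Integrality matters for length five: at most two corners are at 3-vertices, and they use up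
  -- exactly the charge 6.
  · have h1 := two_mul_sum_three_le h f
    rw [faceCharge_of_five_le hf]
    omega

end

end SurfaceEmbedding

/-! ### Conclusion -/

theorem mainTheorem2 {V : Type*} [Fintype V] [Nonempty V] (G : SimpleGraph V)
    [DecidableRel G.Adj] (M : SurfaceEmbedding G) (hM : M.IsToroidal) :
    M.HasReducibleConfiguration := by
  by_contra h
  have h1 := M.sum_charge_le hM
  have h2 := Finset.sum_nonneg fun v (_ : v ∈ Finset.univ) => SurfaceEmbedding.vertexCharge_nonneg h v
  have h3 := Finset.sum_nonneg fun f (_ : f ∈ Finset.univ) => SurfaceEmbedding.faceCharge_nonneg h f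
  have h4 : ∀ v, M.vertexCharge v = 0 := fun v =>
    (Finset.sum_eq_zero_iff_of_nonneg fun v _ => SurfaceEmbedding.vertexCharge_nonneg h v).1
      (by linarith) v (Finset.mem_univ v)
  have h5 : ∀ f, M.faceCharge f = 0 := fun f =>
    (Finset.sum_eq_zero_iff_of_nonneg fun f _ => SurfaceEmbedding.faceCharge_nonneg h f).1
      (by linarith) f (Finset.mem_univ f)
  have hlt : ∀ v, G.degree v < 5 := fun v => by
    by_contra hv
    exact (SurfaceEmbedding.vertexCharge_pos h (not_lt.1 hv)).ne' (h4 v)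
  have hfour : ∀ v, G.degree v = 4 := fun v => by
    have h6 := SurfaceEmbedding.three_le_degree h v
    have h7 := hlt v
    by_contra hv
    obtain ⟨w, hw⟩ := (G.degree_pos_iff_exists_adj v).1 (by omega)
    have h8 := SurfaceEmbedding.five_le_degree_of_adj_three h hw (by omega)
    have h9 := hlt w
    omega
  obtain ⟨v⟩ := ‹Nonempty V›
  obtain ⟨w, hw⟩ := (G.degree_pos_iff_exists_adj v).1 (by rw [hfour]; norm_num)
  set d : G.Dart := ⟨(v, w), hw⟩
  have hlen := M.three_le_len (SurfaceEmbedding.two_le_degree h) (M.face d)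
  rcases (show M.len (M.face d) = 3 ∨ M.len (M.face d) = 4 ∨ 5 ≤ M.len (M.face d) by omega)
    with hf | hf | hf
  · rcases SurfaceEmbedding.five_le_degree_fst_or_snd h d hf with h6 | h6 <;>
      exact absurd h6 (not_le.2 (hlt _))
  · exact h (.fourFaceOfFourVertices _ hf fun v _ => hfour v)
  -- Without 3-vertices a long face keeps its initial charge, which is positive.
  · have h6 := h5 (M.face d)
    rw [SurfaceEmbedding.faceCharge_of_five_le hf, Finset.sum_eq_zero fun e _ =>
      SurfaceEmbedding.ind_of_not (by rw [hfour]; norm_num)] at h6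
    omega
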